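/- **Second moment of the conditional coverage probability.** Let $T_I>0$, $\alpha>2$, $d\ge 0$, $\sigma\in\mathbb{R}$, $\zeta>0$, and for $n\in\{1,2\}$ let $\lambda_n>0$ and $P_n>0$. Let $\Phi_1,\Phi_2$ be independent homogeneous Poisson point processes on $\mathbb{R}^2\times\mathbb{R}$ (location $\times$ start time of a transmission) with densities $\lambda_1,\lambda_2$: $\Phi_1$ models the primary transmitters, and $\Phi_2$ the *active* secondary transmitters (so $\lambda_2$ denotes the density of the active ones; it is $\pi_s$ times the density of all secondary transmitters if each of these transmits with probability $\pi_s$). Independently of these, every point $(x,t_x)$ of each process carries a channel coefficient $h_x$, and the typical link of network $n$, between a transmitter and a receiver at distance $d$, has a channel coefficient $h_0^{(n)}$; all coefficients are i.i.d. exponential with mean $1$. The time-averaged interference at the origin from network $n$ is $$I_n=\frac1{T_I}\int_0^{T_I}P_n\sum_{(x,t_x)\in\Phi_n}\mathbf 1(t_x\le t\le t_x+T_I)\,\frac{h_x}{1+\|x\|^{\alpha}}\,dt ,$$ and the signal-to-interference-plus-noise ratio of the typical receiver of network $n$, located at the origin, is $$\mathrm{SINR}_n=\frac{P_n h_0^{(n)}(1+d^\alpha)^{-1}}{I_1+I_2+\sigma^2}.$$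 Let $q_n^c(\zeta)=\mathbb P(\mathrm{SINR}_n>\zeta\mid\Phi_1,\Phi_2)$ be the conditional coverage probability. Then, for each $n\in\{1,2\}$, with $s=\zeta(1+d^\alpha)/P_n$, $$\mathbb E\big[q_n^c(\zeta)^2\big]=\mathcal L^2_{I_1}(s)\,\mathcal L^2_{I_2}(s)\,e^{-2\sigma^2 s},$$ where, for $m\in\{1,2\}$, $$\mathcal L^2_{I_m}(s)=\exp\left(-4\pi\lambda_m\int_0^{T_I}\int_0^\infty\left(1-\left(\frac1{1+sP_m\chi(t)(1+u^\alpha)^{-1}}\right)^2\right)u\,du\,dt\right),$$ and $\chi(\tau)=\frac1{T_I}\int_0^{T_I}\mathbf 1(\tau\le t\le \tau+T_I)\,dt=\max\left(1-\frac{|\tau|}{T_I},0\right)$. -/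

import Mathlib

open MeasureTheory ProbabilityTheory

noncomputable section

namespace AsyncNetwork

/-- The plane in which the nodes are located. -/
abbrev Plane : Type := EuclideanSpace ℝ (Fin 2)

/-- Time-space points `(x, t)`: a location and the time at which the transmission starts.
`volume` on this type is Lebesgue measure on the plane times Lebesgue measure on the line. -/
abbrev TimeSpace : Type := Plane × ℝ

/-- The random counting measure `∑ i, δ_{Z i}` of a random sequence of points. -/
def countingMeasure {Ω E : Type*} [MeasurableSpace E] (Z : ℕ → Ω → E) (ω : Ω) : Measure E :=
  Measure.sum fun i => Measure.dirac (Z i ω)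

/-- `Φ` is a Poisson point process with intensity measure `Λ`: it is a random measure, the number
of points in a measurable set `B` with `Λ B < ∞` is Poisson distributed with mean `Λ B`, and the
numbers of points in finitely many pairwise disjoint measurable sets are independent. -/
structure IsPoisson {Ω E : Type*} [MeasurableSpace Ω] [MeasurableSpace E]
    (Φ : Ω → Measure E) (Λ : Measure E) (μ : Measure Ω) : Prop where
  measurable : Measurable Φ
  map_apply_eq : ∀ B : Set E, MeasurableSet B → Λ B < ⊤ →
    μ.map (fun ω => Φ ω B) =
      (poissonMeasure (Λ B).toNNReal).map (fun k : ℕ => (k : ENNReal))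
  iIndepFun_apply : ∀ (k : ℕ) (B : Fin k → Set E), (∀ j, MeasurableSet (B j)) →
    (Pairwise fun i j => Disjoint (B i) (B j)) → iIndepFun (fun j ω => Φ ω (B j)) μ

/-- The probabilistic model. Index `0` is the primary network and index `1` the network of active
secondary transmitters. `Z n i` is the `i`-th time-space point of network `n` (the points of each
network form a homogeneous Poisson process of density `lam n`; the two processes are independent).
`h n (some i)` is the channel coefficient from that transmitter to the origin and `h n none` is the
channel coefficient of the typical link of network `n`; the channel coefficients are i.i.d.
exponential with mean one and independent of the points. -/
structure IsModel {Ω : Type*} [MeasurableSpace Ω] (μ : Measure Ω) (lam : Fin 2 → ℝ)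
    (Z : Fin 2 → ℕ → Ω → TimeSpace) (h : Fin 2 → Option ℕ → Ω → ℝ) : Prop where
  measurable_point : ∀ n i, Measurable (Z n i)
  measurable_fading : ∀ n k, Measurable (h n k)
  isPoisson : ∀ n, IsPoisson (countingMeasure (Z n)) (ENNReal.ofReal (lam n) • volume) μ
  map_fading : ∀ n k, μ.map (h n k) = expMeasure 1
  indep_points : IndepFun (fun ω i => Z 0 i ω) (fun ω i => Z 1 i ω) μ
  iIndep_fading : iIndepFun (fun k : Fin 2 × Option ℕ => h k.1 k.2) μ
  indep_points_fading : IndepFun (fun ω (k : Fin 2 × ℕ) => Z k.1 k.2 ω)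
    (fun ω (k : Fin 2 × Option ℕ) => h k.1 k.2 ω) μ

/-- Path loss `(1 + l ^ α)⁻¹` at distance `l`. -/
def pathLoss (α l : ℝ) : ℝ := (1 + l ^ α)⁻¹

/-- `phi T t τ = 1` if a transmission of duration `T` that starts at time `τ` is active at time `t`
and `0` otherwise. -/
def phi (T t τ : ℝ) : ℝ := (Set.Icc τ (τ + T)).indicator (fun _ => 1) t

/-- The fraction of the period `[0, T]` during which a transmission that starts at `τ` is active. -/
def chi (T τ : ℝ) : ℝ := (1 / T) * ∫ t in (0 : ℝ)..T, phi T t τ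

/-- Interference at the origin at time `t` from transmitters of power `P` at the points `Z i` with
channel coefficients `g i`. It is a sum of nonnegative terms, taken in `[0, ∞]`. -/
def interference {Ω : Type*} (T α P : ℝ) (Z : ℕ → Ω → TimeSpace) (g : ℕ → Ω → ℝ)
    (t : ℝ) (ω : Ω) : ENNReal :=
  ENNReal.ofReal P *
    ∑' i, ENNReal.ofReal (phi T t (Z i ω).2 * g i ω * pathLoss α ‖(Z i ω).1‖)

/-- Interference averaged over the period `[0, T]`. -/
def avgInterference {Ω : Type*} (T α P : ℝ) (Z : ℕ → Ω → TimeSpace) (g : ℕ → Ω → ℝ)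
    (ω : Ω) : ENNReal :=
  (ENNReal.ofReal T)⁻¹ * ∫⁻ t in Set.Icc (0 : ℝ) T, interference T α P Z g t ω

/-- SINR at the typical receiver of network `n`, whose transmitter is at distance `d`; the noise
has variance `σ ^ 2`. -/
def sinr {Ω : Type*} (T α d σ : ℝ) (P : Fin 2 → ℝ) (Z : Fin 2 → ℕ → Ω → TimeSpace)
    (h : Fin 2 → Option ℕ → Ω → ℝ) (n : Fin 2) (ω : Ω) : ENNReal :=
  ENNReal.ofReal (P n * h n none ω * pathLoss α d) /
    (avgInterference T α (P 0) (Z 0) (fun i => h 0 (some i)) ω +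
      avgInterference T α (P 1) (Z 1) (fun i => h 1 (some i)) ω + ENNReal.ofReal (σ ^ 2))

/-- The σ-algebra generated by the two point processes (as random measures). -/
@[reducible] def pointSigma {Ω : Type*} (Z : Fin 2 → ℕ → Ω → TimeSpace) : MeasurableSpace Ω :=
  MeasurableSpace.comap (countingMeasure (Z 0)) inferInstance ⊔
    MeasurableSpace.comap (countingMeasure (Z 1)) inferInstance

/-- The conditional coverage probability `ℙ(SINR_n > ζ | point processes)`. -/
def condCoverage {Ω : Type*} [MeasurableSpace Ω] (μ : Measure Ω) (T α d σ : ℝ) (P : Fin 2 → ℝ)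
    (Z : Fin 2 → ℕ → Ω → TimeSpace) (h : Fin 2 → Option ℕ → Ω → ℝ) (n : Fin 2) (ζ : ℝ) :
    Ω → ℝ :=
  μ⟦{ω | ENNReal.ofReal ζ < sinr T α d σ P Z h n ω} | pointSigma Z⟧

/-- The factor `𝓛²_I(s)` of a network with density `lam` and transmit power `P`. -/
def laplaceSq (T α lam P s : ℝ) : ℝ :=
  Real.exp (-4 * Real.pi * lam * ∫ t in (0 : ℝ)..T, ∫ u in Set.Ioi (0 : ℝ),
    (1 - (1 / (1 + s * P * chi T t * (1 + u ^ α)⁻¹)) ^ 2) * u)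

end AsyncNetwork

end

/-! With the points frozen, clearing denominators turns coverage into the event that one unit
exponential exceeds `s * σ ^ 2 + ∑ gᵢ hᵢ`, where `gᵢ` is the `gain` of the `i`-th point and the `hᵢ`
are further independent unit exponentials. Since the tail of a unit exponential is `exp (-c)`, this
has probability `exp (-s σ²) ∏ 1 / (1 + gᵢ)`, that is, `exp` of minus `s σ² + ∑ log (1 + gᵢ)`
(`measure_const_add_tsum_lt`, `condCoverage_ae_eq`).

Squaring doubles the exponent, so the second moment is a Laplace functional of the two independent
Poisson processes at `2 log (1 + g)` (`IsPoisson.lintegral_expNeg`). Each contributes `exp (-λ ∫ (1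
- (1 / (1 + g))²))`, and `integral_one_sub_sq_gain` evaluates the integral: polar coordinates give
`2π`, evenness of `chi` another factor `2`.

Probabilities are computed in `[0, ∞]`, where `exp (-∞) = 0`, so almost sure finiteness of the
interference is never needed. -/

namespace AsyncNetwork

open Filter Topology
open scoped ENNReal

/-! ### The exponential `exp (-x)` on `[0, ∞]`. -/

/-- The function `x ↦ exp (-x)` on `[0, ∞]`. -/
noncomputable def expNeg (x : ℝ≥0∞) : ℝ≥0∞ := (EReal.exp (x : EReal))⁻¹

theorem continuous_expNeg : Continuous expNeg :=
  continuous_inv.comp (ENNReal.continuous_exp.comp continuous_coe_ennreal_ereal)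

theorem measurable_expNeg : Measurable expNeg := continuous_expNeg.measurable

theorem antitone_expNeg : Antitone expNeg := fun _ _ h =>
  ENNReal.inv_le_inv.2 (EReal.exp_monotone (EReal.coe_ennreal_le_coe_ennreal_iff.2 h))

@[simp] theorem expNeg_zero : expNeg 0 = 1 := by simp [expNeg]

@[simp] theorem expNeg_top : expNeg ⊤ = 0 := by simp [expNeg]

theorem expNeg_le_one (x : ℝ≥0∞) : expNeg x ≤ 1 := by
  simpa using antitone_expNeg (zero_le (a := x))

theorem expNeg_ne_top (x : ℝ≥0∞) : expNeg x ≠ ⊤ := ne_top_of_le_ne_top ENNReal.one_ne_top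
  (expNeg_le_one x)

theorem expNeg_add (x y : ℝ≥0∞) : expNeg (x + y) = expNeg x * expNeg y := by
  rw [expNeg, EReal.coe_ennreal_add, EReal.exp_add, ENNReal.mul_inv, expNeg, expNeg]
  · left
    intro h
    have := EReal.exp_eq_zero_iff.1 h
    exact absurd this (EReal.coe_ennreal_ne_bot _)
  · right
    intro h
    have := EReal.exp_eq_zero_iff.1 h
    exact absurd this (EReal.coe_ennreal_ne_bot _)

theorem expNeg_ofReal {x : ℝ} (hx : 0 ≤ x) :
    expNeg (ENNReal.ofReal x) = ENNReal.ofReal (Real.exp (-x)) := by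
  rw [expNeg, EReal.coe_ennreal_ofReal, max_eq_left hx, EReal.exp_coe, Real.exp_neg,
    ENNReal.ofReal_inv_of_pos (Real.exp_pos _)]

theorem expNeg_sum {ι : Type*} (t : Finset ι) (f : ι → ℝ≥0∞) :
    expNeg (∑ i ∈ t, f i) = ∏ i ∈ t, expNeg (f i) := by
  classical
  induction t using Finset.induction_on with
  | empty => simp
  | insert a t ha ih => rw [Finset.sum_insert ha, Finset.prod_insert ha, expNeg_add, ih]

theorem expNeg_nat_mul (k : ℕ) (x : ℝ≥0∞) : expNeg (k * x) = expNeg x ^ k := by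
  have := expNeg_sum (Finset.range k) (fun _ => x)
  simpa using this

/-- The exponential series in `r * exp (-c)`, multiplied by `exp (-r)`. -/
theorem lintegral_expNeg_poissonMeasure (r : NNReal) {c : ℝ≥0∞} (hc : c ≠ ⊤) :
    ∫⁻ k : ℕ, expNeg (c * k) ∂poissonMeasure r = expNeg ((1 - expNeg c) * r) := by
  lift c to NNReal using hc
  have hE : expNeg (c : ℝ≥0∞) = ENNReal.ofReal (Real.exp (-c)) := by
    rw [← ENNReal.ofReal_coe_nnreal, expNeg_ofReal (NNReal.coe_nonneg c)]
  have hR : (1 - expNeg (c : ℝ≥0∞)) * r = ENNReal.ofReal ((1 - Real.exp (-c)) * r) := by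
    rw [hE, ← ENNReal.ofReal_one, ← ENNReal.ofReal_sub _ (Real.exp_pos _).le,
      ENNReal.ofReal_mul' (NNReal.coe_nonneg r), ENNReal.ofReal_coe_nnreal]
  have h1 : (0 : ℝ) ≤ 1 - Real.exp (-c) := by simp
  rw [hR, expNeg_ofReal (mul_nonneg h1 (NNReal.coe_nonneg r)), poissonMeasure, lintegral_sum_measure]
  have hs : ∀ k : ℕ, ∫⁻ a : ℕ, expNeg (c * a)
        ∂(ENNReal.ofReal (Real.exp (-r) * r ^ k / (k.factorial : ℝ)) • Measure.dirac k)
      = ENNReal.ofReal (Real.exp (-r) * ((r * Real.exp (-c)) ^ k / (k.factorial : ℝ))) := by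
    intro k
    rw [lintegral_smul_measure, lintegral_dirac, mul_comm (c : ℝ≥0∞), expNeg_nat_mul, hE,
      ← ENNReal.ofReal_pow (Real.exp_pos _).le, smul_eq_mul, ← ENNReal.ofReal_mul (by positivity),
      mul_pow]
    congr 1
    ring
  simp_rw [hs]
  have hsum := (NormedSpace.expSeries_div_hasSum_exp ((r : ℝ) * Real.exp (-c))).mul_left
    (Real.exp (-r))
  rw [← ENNReal.ofReal_tsum_of_nonneg (fun k => by positivity) hsum.summable, hsum.tsum_eq,
    ← Real.exp_eq_exp_ℝ, ← Real.exp_add]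
  congr 2
  ring

/-! ### Laplace functional of a Poisson process. -/

section Poisson

variable {Ω E : Type*} [MeasurableSpace Ω] [MeasurableSpace E]

/-- Finiteness of `Λ B` is required only for `c ≠ 0` because the zero level set of a simple function
may have infinite intensity. -/
theorem IsPoisson.lintegral_expNeg_apply {Φ : Ω → Measure E} {Λ : Measure E} {μ : Measure Ω}
    (hΦ : IsPoisson Φ Λ μ) {B : Set E} (hB : MeasurableSet B) {c : ℝ≥0∞} (hc : c ≠ ⊤)
    (h : c ≠ 0 → Λ B < ⊤) [IsProbabilityMeasure μ] :
    ∫⁻ ω, expNeg (c * Φ ω B) ∂μ = expNeg ((1 - expNeg c) * Λ B) := by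
  rcases eq_or_ne c 0 with rfl | h0
  · simp
  have hm : Measurable fun ω => Φ ω B := (Measure.measurable_coe hB).comp hΦ.measurable
  have hf : Measurable fun x : ℝ≥0∞ => expNeg (c * x) :=
    measurable_expNeg.comp (measurable_const.mul measurable_id)
  rw [← lintegral_map hf hm, hΦ.map_apply_eq B hB (h h0), lintegral_map hf .of_discrete,
    lintegral_expNeg_poissonMeasure _ hc, ENNReal.coe_toNNReal (h h0).ne]

/-- The level sets are disjoint, so their counts are independent and the expectation factors over
the values of `f`. -/
theorem IsPoisson.lintegral_expNeg_simpleFunc {Φ : Ω → Measure E} {Λ : Measure E} {μ : Measure Ω}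
    [IsProbabilityMeasure μ] (hΦ : IsPoisson Φ Λ μ) (f : SimpleFunc E ℝ≥0∞)
    (hf : ∀ x, f x ≠ ⊤) (hfin : ∀ c, c ≠ 0 → Λ (f ⁻¹' {c}) < ⊤) :
    ∫⁻ ω, expNeg (∫⁻ x, f x ∂Φ ω) ∂μ = expNeg (∫⁻ x, (1 - expNeg (f x)) ∂Λ) := by
  classical
  have hmeas (c : ℝ≥0∞) : MeasurableSet (f ⁻¹' {c}) := f.measurableSet_preimage _
  set e := f.range.equivFin
  have hL (ω : Ω) : expNeg (∫⁻ x, f x ∂Φ ω)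
      = ∏ j, expNeg ((e.symm j : ℝ≥0∞) * Φ ω (f ⁻¹' {(e.symm j : ℝ≥0∞)})) := by
    rw [SimpleFunc.lintegral_eq_lintegral, SimpleFunc.lintegral, expNeg_sum,
      ← Finset.prod_coe_sort, ← Equiv.prod_comp e.symm]
  have hR : ∫⁻ x, (1 - expNeg (f x)) ∂Λ
      = ∑ j, (1 - expNeg (e.symm j : ℝ≥0∞)) * Λ (f ⁻¹' {(e.symm j : ℝ≥0∞)}) := by
    have := SimpleFunc.lintegral_eq_lintegral (f.map fun y => 1 - expNeg y) Λ
    rw [SimpleFunc.map_lintegral] at this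
    simp only [SimpleFunc.map_apply] at this
    rw [this, ← Finset.sum_coe_sort, ← Equiv.sum_comp e.symm]
  have hind := hΦ.iIndepFun_apply _ (fun j => f ⁻¹' {(e.symm j : ℝ≥0∞)}) (fun j => hmeas _) (by
    intro i j hij
    refine Disjoint.preimage _ (Set.disjoint_singleton.2 fun h => hij ?_)
    exact e.symm.injective (Subtype.ext h))
  have hg (c : ℝ≥0∞) : Measurable fun x : ℝ≥0∞ => expNeg (c * x) :=
    measurable_expNeg.comp (measurable_const.mul measurable_id)
  have hind' := hind.comp (fun j x => expNeg ((e.symm j : ℝ≥0∞) * x)) (fun j => hg _)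
  simp_rw [hL]
  have hmΦ (B : Set E) (hB : MeasurableSet B) : Measurable fun ω => Φ ω B :=
    (Measure.measurable_coe hB).comp hΦ.measurable
  have := lintegral_prod_eq_prod_lintegral_of_indepFun Finset.univ
    (fun j ω => expNeg ((e.symm j : ℝ≥0∞) * Φ ω (f ⁻¹' {(e.symm j : ℝ≥0∞)}))) hind'
    (fun j => (hg _).comp (hmΦ _ (hmeas _)))
  rw [this, hR, expNeg_sum]
  refine Finset.prod_congr rfl fun j _ => hΦ.lintegral_expNeg_apply (hmeas _) ?_ (hfin _)
  obtain ⟨x, hx⟩ := SimpleFunc.mem_range.1 (e.symm j).2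
  rw [← hx]
  exact hf x

/-- The Laplace functional of a Poisson point process. -/
theorem IsPoisson.lintegral_expNeg {Φ : Ω → Measure E} {Λ : Measure E} {μ : Measure Ω}
    [IsProbabilityMeasure μ] [SigmaFinite Λ] (hΦ : IsPoisson Φ Λ μ) {f : E → ℝ≥0∞}
    (hf : Measurable f) :
    ∫⁻ ω, expNeg (∫⁻ x, f x ∂Φ ω) ∂μ = expNeg (∫⁻ x, (1 - expNeg (f x)) ∂Λ) := by
  -- Cutting off outside the spanning sets gives every nonzero level set finite intensity, while `g
  -- n` still increases to `f`.
  set g : ℕ → SimpleFunc E ℝ≥0∞ := fun n =>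
    (SimpleFunc.eapprox f n).restrict (spanningSets Λ n)
  have hS (n : ℕ) : MeasurableSet (spanningSets Λ n) := measurableSet_spanningSets Λ n
  have hga (n : ℕ) (x : E) :
      g n x = (spanningSets Λ n).indicator (SimpleFunc.eapprox f n) x := by
    rw [SimpleFunc.restrict_apply _ (hS n)]
  have hmono : Monotone fun n => (g n : E → ℝ≥0∞) := by
    intro m n hmn x
    simp only [hga]
    refine (Set.indicator_le_indicator (SimpleFunc.monotone_eapprox f hmn x)).trans ?_
    exact Set.indicator_le_indicator_of_subset (monotone_spanningSets Λ hmn)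
      (fun _ => zero_le) x
  have hlim (x : E) : Tendsto (fun n => g n x) atTop (𝓝 (f x)) := by
    have h1 : Tendsto (fun n => SimpleFunc.eapprox f n x) atTop (𝓝 (f x)) := by
      rw [← SimpleFunc.iSup_eapprox_apply hf x]
      exact tendsto_atTop_iSup fun m n hmn => SimpleFunc.monotone_eapprox f hmn x
    refine h1.congr' ?_
    filter_upwards [eventually_ge_atTop (spanningSetsIndex Λ x)] with n hn
    rw [hga, Set.indicator_of_mem]
    exact monotone_spanningSets Λ hn (mem_spanningSetsIndex Λ x)
  have hfin (n : ℕ) (c : ℝ≥0∞) (hc : c ≠ 0) : Λ (g n ⁻¹' {c}) < ⊤ := by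
    refine lt_of_le_of_lt (measure_mono ?_) (measure_spanningSets_lt_top Λ n)
    intro x hx
    by_contra hxn
    rw [Set.mem_preimage, hga, Set.indicator_of_notMem hxn] at hx
    exact hc hx.symm
  have htop (n : ℕ) (x : E) : g n x ≠ ⊤ := by
    rw [hga]
    by_cases hx : x ∈ spanningSets Λ n
    · rw [Set.indicator_of_mem hx]
      exact (SimpleFunc.eapprox_lt_top f n x).ne
    · simp [Set.indicator_of_notMem hx]
  have key (n : ℕ) := hΦ.lintegral_expNeg_simpleFunc (g n) (htop n) (hfin n)
  have hmI (n : ℕ) : Measurable fun ω => expNeg (∫⁻ x, g n x ∂Φ ω) :=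
    measurable_expNeg.comp ((Measure.measurable_lintegral (g n).measurable).comp hΦ.measurable)
  have hleft : Tendsto (fun n => ∫⁻ ω, expNeg (∫⁻ x, g n x ∂Φ ω) ∂μ) atTop
      (𝓝 (∫⁻ ω, expNeg (∫⁻ x, f x ∂Φ ω) ∂μ)) := by
    refine tendsto_lintegral_of_dominated_convergence (fun _ => 1) hmI
      (fun n => ae_of_all _ fun ω => expNeg_le_one _) (by simp) (ae_of_all _ fun ω => ?_)
    exact (continuous_expNeg.tendsto _).comp (lintegral_tendsto_of_tendsto_of_monotone
      (fun n => (g n).measurable.aemeasurable) (ae_of_all _ fun x m n hmn => hmono hmn x)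
      (ae_of_all _ hlim))
  have hright : Tendsto (fun n => expNeg (∫⁻ x, (1 - expNeg (g n x)) ∂Λ)) atTop
      (𝓝 (expNeg (∫⁻ x, (1 - expNeg (f x)) ∂Λ))) := by
    refine (continuous_expNeg.tendsto _).comp (lintegral_tendsto_of_tendsto_of_monotone
      (fun n => (measurable_const.sub (measurable_expNeg.comp (g n).measurable)).aemeasurable)
      (ae_of_all _ fun x m n hmn => tsub_le_tsub_left (antitone_expNeg (hmono hmn x)) _)
      (ae_of_all _ fun x => ?_))
    exact ENNReal.Tendsto.sub tendsto_const_nhds ((continuous_expNeg.tendsto _).comp (hlim x))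
      (Or.inl ENNReal.one_ne_top)
  simp_rw [key] at hleft
  exact tendsto_nhds_unique hleft hright

end Poisson

/-! ### Exponential fading for fixed points. -/

theorem expNeg_ofReal_log_one_add {a : ℝ} (ha : 0 ≤ a) :
    expNeg (ENNReal.ofReal (Real.log (1 + a))) = ENNReal.ofReal (1 / (1 + a)) := by
  rw [expNeg_ofReal (Real.log_nonneg (by linarith)), Real.exp_neg, Real.exp_log (by linarith),
    one_div]

/-- Tilting the unit exponential density by `exp (-a x)` gives `1 / (1 + a)` times the density of
rate `1 + a`. The logarithmic form of the value lets products over points become sums. -/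
theorem lintegral_expNeg_expMeasure {a : ℝ} (ha : 0 ≤ a) :
    ∫⁻ x, expNeg (ENNReal.ofReal a * ENNReal.ofReal x) ∂expMeasure 1
      = expNeg (ENNReal.ofReal (Real.log (1 + a))) := by
  have hm (r : ℝ) : Measurable (exponentialPDF r) :=
    (measurable_exponentialPDFReal r).ennreal_ofReal
  have hd : expMeasure 1 = volume.withDensity (exponentialPDF 1) := rfl
  have hpt (x : ℝ) : exponentialPDF 1 x * expNeg (ENNReal.ofReal a * ENNReal.ofReal x)
      = ENNReal.ofReal (1 / (1 + a)) * exponentialPDF (1 + a) x := by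
    rcases lt_or_ge x 0 with hx | hx
    · simp [exponentialPDF_of_neg hx]
    · rw [exponentialPDF_of_nonneg hx, exponentialPDF_of_nonneg hx, ← ENNReal.ofReal_mul ha,
        expNeg_ofReal (mul_nonneg ha hx), ← ENNReal.ofReal_mul (by positivity),
        ← ENNReal.ofReal_mul (by positivity), one_mul, ← Real.exp_add]
      congr 1
      field_simp
      congr 1
      ring
  rw [hd, lintegral_withDensity_eq_lintegral_mul _ (hm 1) (by
    exact measurable_expNeg.comp (measurable_const.mul ENNReal.measurable_ofReal))]
  simp only [Pi.mul_apply, hpt]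
  rw [lintegral_const_mul _ (hm _), lintegral_exponentialPDF_eq_one (by linarith), mul_one,
    expNeg_ofReal_log_one_add ha]

theorem expMeasure_setOf_lt_ofReal (c : ℝ≥0∞) :
    expMeasure 1 {x | c < ENNReal.ofReal x} = expNeg c := by
  have := isProbabilityMeasure_expMeasure one_pos
  rcases eq_or_ne c ⊤ with rfl | hc
  · simp
  have hset : {x | c < ENNReal.ofReal x} = (Set.Iic c.toReal)ᶜ := by
    ext x
    simp [ENNReal.lt_ofReal_iff_toReal_lt hc]
  have h0 : 0 ≤ c.toReal := ENNReal.toReal_nonneg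
  rw [hset, prob_compl_eq_one_sub measurableSet_Iic, ← ofReal_cdf, cdf_expMeasure_eq one_pos,
    if_pos h0, one_mul, ← ENNReal.ofReal_one, ← ENNReal.ofReal_sub _ (by simp)]
  conv_rhs => rw [← ENNReal.ofReal_toReal hc, expNeg_ofReal h0]
  congr 1
  ring

section Fading

variable {Ω : Type*} [MeasurableSpace Ω] {μ : Measure Ω}

/-- Independence settles finite partial sums; dominated convergence with bound `1` passes to the
limit, even if the series diverges. -/
theorem lintegral_expNeg_tsum [IsProbabilityMeasure μ] {ι : Type*} [Countable ι] {X : ι → Ω → ℝ} {a : ι → ℝ}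
    (hX : ∀ i, Measurable (X i)) (hlaw : ∀ i, μ.map (X i) = expMeasure 1)
    (hind : iIndepFun X μ) (ha : ∀ i, 0 ≤ a i) :
    ∫⁻ ω, expNeg (∑' i, ENNReal.ofReal (a i) * ENNReal.ofReal (X i ω)) ∂μ
      = expNeg (∑' i, ENNReal.ofReal (Real.log (1 + a i))) := by
  have hg (i : ι) : Measurable fun x : ℝ => expNeg (ENNReal.ofReal (a i) * ENNReal.ofReal x) :=
    measurable_expNeg.comp (measurable_const.mul ENNReal.measurable_ofReal)
  have hfin (t : Finset ι) :
      ∫⁻ ω, expNeg (∑ i ∈ t, ENNReal.ofReal (a i) * ENNReal.ofReal (X i ω)) ∂μ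
        = expNeg (∑ i ∈ t, ENNReal.ofReal (Real.log (1 + a i))) := by
    simp_rw [expNeg_sum]
    rw [lintegral_prod_eq_prod_lintegral_of_indepFun t
      (fun i ω => expNeg (ENNReal.ofReal (a i) * ENNReal.ofReal (X i ω)))
      (hind.comp _ hg) (fun i => (hg i).comp (hX i))]
    refine Finset.prod_congr rfl fun i _ => ?_
    rw [← lintegral_expNeg_expMeasure (ha i), ← hlaw i, lintegral_map (hg i) (hX i)]
  have hleft : Tendsto (fun t : Finset ι =>
      ∫⁻ ω, expNeg (∑ i ∈ t, ENNReal.ofReal (a i) * ENNReal.ofReal (X i ω)) ∂μ) atTop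
      (𝓝 (∫⁻ ω, expNeg (∑' i, ENNReal.ofReal (a i) * ENNReal.ofReal (X i ω)) ∂μ)) := by
    refine tendsto_lintegral_filter_of_dominated_convergence (fun _ => 1)
      (Eventually.of_forall fun t => ?_)
      (Eventually.of_forall fun t => ae_of_all _ fun ω => expNeg_le_one _) (by simp)
      (ae_of_all _ fun ω => ?_)
    · exact measurable_expNeg.comp (Finset.measurable_fun_sum t fun i _ =>
        measurable_const.mul (ENNReal.measurable_ofReal.comp (hX i)))
    · exact (continuous_expNeg.tendsto _).comp ENNReal.summable.hasSum
  simp_rw [hfin] at hleft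
  exact tendsto_nhds_unique hleft ((continuous_expNeg.tendsto _).comp ENNReal.summable.hasSum)

theorem measure_lt_ofReal_of_indepFun [IsProbabilityMeasure μ] {X : Ω → ℝ} {J : Ω → ℝ≥0∞} (hX : Measurable X)
    (hJ : Measurable J) (hlaw : μ.map X = expMeasure 1) (hind : IndepFun J X μ) :
    μ {ω | J ω < ENNReal.ofReal (X ω)} = ∫⁻ ω, expNeg (J ω) ∂μ := by
  have hprod := (indepFun_iff_map_prod_eq_prod_map_map hJ.aemeasurable hX.aemeasurable).1 hind
  have hS : MeasurableSet {p : ℝ≥0∞ × ℝ | p.1 < ENNReal.ofReal p.2} :=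
    measurableSet_lt measurable_fst (ENNReal.measurable_ofReal.comp measurable_snd)
  have h1 : μ {ω | J ω < ENNReal.ofReal (X ω)}
      = μ.map (fun ω => (J ω, X ω)) {p : ℝ≥0∞ × ℝ | p.1 < ENNReal.ofReal p.2} := by
    rw [Measure.map_apply (hJ.prodMk hX) hS]
    rfl
  have := isProbabilityMeasure_expMeasure one_pos
  rw [h1, hprod, hlaw, Measure.prod_apply hS, ← lintegral_map measurable_expNeg hJ]
  refine lintegral_congr fun c => ?_
  exact expMeasure_setOf_lt_ofReal c

theorem indepFun_pi_of_notMem_range {K ι : Type*} {X : K → Ω → ℝ}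
    (hX : ∀ k, Measurable (X k)) (hind : iIndepFun X μ) {e : ι → K} {k : K}
    (hk : k ∉ Set.range e) : IndepFun (fun ω i => X (e i) ω) (X k) μ := by
  have h := indep_iSup_of_disjoint (fun k => (hX k).comap_le) hind
    (Set.disjoint_singleton_right.2 hk)
  refine indep_of_indep_of_le_left (indep_of_indep_of_le_right h ?_) ?_
  · simp
  · rw [MeasurableSpace.pi, MeasurableSpace.comap_iSup]
    refine iSup_le fun i => ?_
    rw [MeasurableSpace.comap_comp]
    exact le_iSup₂_of_le (e i) ⟨i, rfl⟩ le_rfl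

/-- The coverage probability for frozen points: `k` indexes the typical link, `e` the interferers,
and `c` is the noise. -/
theorem measure_const_add_tsum_lt [IsProbabilityMeasure μ] {K ι : Type*} [Countable ι] {X : K → Ω → ℝ} {a : ι → ℝ}
    (hX : ∀ k, Measurable (X k)) (hlaw : ∀ k, μ.map (X k) = expMeasure 1)
    (hind : iIndepFun X μ) {e : ι → K} (he : e.Injective) {k : K} (hk : k ∉ Set.range e)
    (ha : ∀ i, 0 ≤ a i) (c : ℝ≥0∞) :
    μ {ω | c + ∑' i, ENNReal.ofReal (a i) * ENNReal.ofReal (X (e i) ω)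
        < ENNReal.ofReal (X k ω)}
      = expNeg (c + ∑' i, ENNReal.ofReal (Real.log (1 + a i))) := by
  have hF : Measurable fun x : ι → ℝ => c + ∑' i, ENNReal.ofReal (a i) * ENNReal.ofReal (x i) :=
    measurable_const.add (Measurable.tsum fun i =>
      measurable_const.mul (ENNReal.measurable_ofReal.comp (measurable_pi_apply i)))
  have h := (indepFun_pi_of_notMem_range hX hind hk).comp hF measurable_id
  rw [measure_lt_ofReal_of_indepFun (J := fun ω => c + ∑' i, ENNReal.ofReal (a i) *
    ENNReal.ofReal (X (e i) ω)) (hX k) (hF.comp (measurable_pi_lambda _ fun i => hX (e i)))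
    (hlaw k) h]
  simp_rw [expNeg_add]
  rw [lintegral_const_mul' _ _ (expNeg_ne_top c),
    lintegral_expNeg_tsum (fun i => hX (e i)) (fun i => hlaw (e i)) (hind.precomp he) ha]

end Fading

/-! ### Conditioning by freezing the points. -/

/-- Freezing: the conditional probability of an event determined by a pair of independent random
elements, given a `σ`-algebra generated by part of the first one. -/
theorem condExp_indicator_of_indepFun {Ω β γ : Type*} {m : MeasurableSpace Ω}
    [m0 : MeasurableSpace Ω] {μ : Measure Ω} [IsProbabilityMeasure μ] [MeasurableSpace β] [MeasurableSpace γ]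
    {Y : Ω → β} {H : Ω → γ} (hY : Measurable Y) (hH : Measurable H) (hind : IndepFun Y H μ)
    {A : Set (β × γ)} (hA : MeasurableSet A)
    (hm : m ≤ MeasurableSpace.comap Y inferInstance) {G : β → ℝ≥0∞}
    (hG : ∀ y, μ {ω | (y, H ω) ∈ A} = G y) (hGm : Measurable[m] fun ω => G (Y ω)) :
    μ⟦{ω | (Y ω, H ω) ∈ A} | m⟧ =ᵐ[μ] fun ω => (G (Y ω)).toReal := by
  have hm0 : m ≤ m0 := hm.trans hY.comap_le
  have hAm : MeasurableSet {ω | (Y ω, H ω) ∈ A} := (hY.prodMk hH) hA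
  have hG1 (y : β) : G y ≤ 1 := by rw [← hG]; exact prob_le_one
  have hGi : Integrable (fun ω => (G (Y ω)).toReal) μ := by
    refine Integrable.of_bound ((hGm.mono hm0 le_rfl).ennreal_toReal.aestronglyMeasurable) 1
      (ae_of_all _ fun ω => ?_)
    rw [Real.norm_of_nonneg ENNReal.toReal_nonneg]
    simpa using ENNReal.toReal_mono ENNReal.one_ne_top (hG1 (Y ω))
  symm
  refine ae_eq_condExp_of_forall_setIntegral_eq hm0
    ((integrable_const (1 : ℝ)).indicator hAm) (fun s _ _ => hGi.integrableOn)
    (fun s hs _ => ?_) (hGm.ennreal_toReal.stronglyMeasurable.aestronglyMeasurable)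
  -- Every test set of `m` is a preimage under `Y`, so the defining identity reduces to Fubini for
  -- the product law of `(Y, H)`.
  obtain ⟨B, hB, rfl⟩ := hm s hs
  have hGB : (fun y => G y) = fun y => μ.map H (Prod.mk y ⁻¹' A) := by
    funext y
    rw [← hG, Measure.map_apply hH (measurable_prodMk_left hA)]
    rfl
  have hGY : Measurable G := by
    rw [show G = fun y => G y from rfl, hGB]
    have : IsProbabilityMeasure (μ.map H) := Measure.isProbabilityMeasure_map hH.aemeasurable
    exact measurable_measure_prodMk_left hA
  rw [integral_toReal (f := fun ω => G (Y ω)) (hGY.comp hY).aemeasurable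
      (ae_of_all _ fun ω => (hG1 _).trans_lt ENNReal.one_lt_top),
    integral_indicator hAm, setIntegral_const, smul_eq_mul, mul_one, measureReal_restrict_apply hAm,
    measureReal_def]
  congr 1
  have hprod := (indepFun_iff_map_prod_eq_prod_map_map hY.aemeasurable hH.aemeasurable).1 hind
  have h1 : {ω | (Y ω, H ω) ∈ A} ∩ Y ⁻¹' B = (fun ω => (Y ω, H ω)) ⁻¹' (A ∩ Prod.fst ⁻¹' B) := rfl
  have : IsProbabilityMeasure (μ.map H) := Measure.isProbabilityMeasure_map hH.aemeasurable
  have hAB : MeasurableSet (A ∩ Prod.fst ⁻¹' B) := hA.inter (measurable_fst hB)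
  rw [h1, ← Measure.map_apply (hY.prodMk hH) hAB, hprod, Measure.prod_apply hAB,
    ← setLIntegral_map hB hGY hY, ← lintegral_indicator hB]
  refine lintegral_congr fun y => ?_
  by_cases hy : y ∈ B
  · rw [Set.indicator_of_mem hy, congrFun hGB y]
    congr 1
    ext z
    simp [hy]
  · rw [Set.indicator_of_notMem hy]
    symm
    convert measure_empty (μ := μ.map H)
    ext z
    simp [hy]

/-! ### Time-averaged activity, path loss and gain. -/

/-- The windows `[τ, τ + T]` and `[0, T]` overlap in length `T - |τ|`; `ENNReal.ofReal` truncates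
this to `0` when they are disjoint. -/
theorem setLIntegral_phi (T τ : ℝ) :
    ∫⁻ t in Set.Icc (0 : ℝ) T, ENNReal.ofReal (phi T t τ) = ENNReal.ofReal (T - |τ|) := by
  have h1 : (fun t => ENNReal.ofReal (phi T t τ)) = (Set.Icc τ (τ + T)).indicator 1 := by
    funext t
    by_cases ht : t ∈ Set.Icc τ (τ + T)
    · simp only [phi, Set.indicator_of_mem ht, Pi.one_apply, ENNReal.ofReal_one]
    · simp only [phi, Set.indicator_of_notMem ht, ENNReal.ofReal_zero]
  rw [h1, lintegral_indicator_one measurableSet_Icc, Measure.restrict_apply measurableSet_Icc,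
    Set.Icc_inter_Icc, Real.volume_Icc]
  congr 1
  rcases le_total 0 τ with h | h
  · rw [abs_of_nonneg h, sup_eq_left.2 h, inf_eq_right.2 (by linarith)]
  · rw [abs_of_nonpos h, sup_eq_right.2 h, inf_eq_left.2 (by linarith)]
    ring

theorem phi_nonneg (T t τ : ℝ) : 0 ≤ phi T t τ :=
  Set.indicator_nonneg (fun _ _ => zero_le_one) _

theorem measurable_phi (T τ : ℝ) : Measurable fun t => phi T t τ :=
  measurable_const.indicator measurableSet_Icc

theorem chi_eq_max {T : ℝ} (hT : 0 < T) (τ : ℝ) : chi T τ = max (1 - |τ| / T) 0 := by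
  rw [chi, intervalIntegral.integral_of_le hT.le, ← integral_Icc_eq_integral_Ioc,
    integral_eq_lintegral_of_nonneg_ae (ae_of_all _ fun t => phi_nonneg T t τ)
      (measurable_phi T τ).aestronglyMeasurable, setLIntegral_phi, ENNReal.toReal_ofReal',
    mul_max_of_nonneg _ _ (by positivity)]
  congr 1
  · field_simp
  · simp

theorem chi_nonneg {T : ℝ} (hT : 0 < T) (τ : ℝ) : 0 ≤ chi T τ := by
  rw [chi_eq_max hT]
  exact le_max_right _ _

theorem chi_le_one {T : ℝ} (hT : 0 < T) (τ : ℝ) : chi T τ ≤ 1 := by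
  rw [chi_eq_max hT]
  exact max_le (by have : 0 ≤ |τ| / T := by positivity
                   linarith) zero_le_one

theorem chi_abs {T : ℝ} (hT : 0 < T) (τ : ℝ) : chi T |τ| = chi T τ := by
  rw [chi_eq_max hT, chi_eq_max hT, abs_abs]

theorem chi_eq_zero {T : ℝ} (hT : 0 < T) {τ : ℝ} (h : T < τ) : chi T τ = 0 := by
  rw [chi_eq_max hT, abs_of_pos (hT.trans h)]
  refine max_eq_right ?_
  have : 1 < τ / T := (one_lt_div hT).2 h
  linarith

theorem measurable_chi {T : ℝ} (hT : 0 < T) : Measurable (chi T) := by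
  rw [show chi T = fun τ => max (1 - |τ| / T) 0 from funext (chi_eq_max hT)]
  fun_prop

theorem measurable_pathLoss (α : ℝ) : Measurable (pathLoss α) := by
  unfold pathLoss
  fun_prop

theorem pathLoss_pos (α : ℝ) {l : ℝ} (hl : 0 ≤ l) : 0 < pathLoss α l := by
  unfold pathLoss
  have := Real.rpow_nonneg hl α
  positivity

theorem setLIntegral_phi_eq_mul_chi {T : ℝ} (hT : 0 < T) (τ : ℝ) :
    ∫⁻ t in Set.Icc (0 : ℝ) T, ENNReal.ofReal (phi T t τ)
      = ENNReal.ofReal T * ENNReal.ofReal (chi T τ) := by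
  rw [setLIntegral_phi, ← ENNReal.ofReal_mul hT.le, chi_eq_max hT, mul_max_of_nonneg _ _ hT.le,
    mul_zero, ENNReal.ofReal_max, ENNReal.ofReal_zero, max_eq_left zero_le]
  congr 1
  field_simp

theorem avgInterference_eq_tsum {Ω : Type*} {T : ℝ} (hT : 0 < T) (α : ℝ) (P : ℝ)
    (Z : ℕ → Ω → TimeSpace) (g : ℕ → Ω → ℝ) (ω : Ω) :
    avgInterference T α P Z g ω = ∑' i, ENNReal.ofReal P * (ENNReal.ofReal (chi T (Z i ω).2) *
      (ENNReal.ofReal (pathLoss α ‖(Z i ω).1‖) * ENNReal.ofReal (g i ω))) := by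
  have hT0 : ENNReal.ofReal T ≠ 0 := by simpa using hT
  have hterm (t : ℝ) (i : ℕ) :
      ENNReal.ofReal (phi T t (Z i ω).2 * g i ω * pathLoss α ‖(Z i ω).1‖)
        = ENNReal.ofReal (phi T t (Z i ω).2) *
          (ENNReal.ofReal (pathLoss α ‖(Z i ω).1‖) * ENNReal.ofReal (g i ω)) := by
    rw [mul_assoc, ENNReal.ofReal_mul (phi_nonneg _ _ _), mul_comm (g i ω),
      ENNReal.ofReal_mul (pathLoss_pos α (norm_nonneg _)).le]
  have hm (i : ℕ) : Measurable fun t => ENNReal.ofReal (phi T t (Z i ω).2) :=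
    (measurable_phi T _).ennreal_ofReal
  simp only [avgInterference, interference, hterm]
  rw [lintegral_const_mul' _ _ ENNReal.ofReal_ne_top,
    lintegral_tsum (fun i => ((hm i).mul_const _).aemeasurable), ENNReal.tsum_mul_left,
    mul_left_comm, ← ENNReal.tsum_mul_left]
  congr 1
  refine tsum_congr fun i => ?_
  rw [lintegral_mul_const _ (hm i), setLIntegral_phi_eq_mul_chi hT, mul_assoc, ← mul_assoc,
    ENNReal.inv_mul_cancel hT0 ENNReal.ofReal_ne_top, one_mul]

/-- `c` times the time-averaged path gain to the origin of a transmission from the point `x`. -/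
noncomputable def gain (T α c : ℝ) (x : TimeSpace) : ℝ := c * chi T x.2 * pathLoss α ‖x.1‖

theorem gain_nonneg {T : ℝ} (hT : 0 < T) (α : ℝ) {c : ℝ} (hc : 0 ≤ c) (x : TimeSpace) :
    0 ≤ gain T α c x :=
  mul_nonneg (mul_nonneg hc (chi_nonneg hT _)) (pathLoss_pos α (norm_nonneg _)).le

theorem measurable_gain {T : ℝ} (hT : 0 < T) (α c : ℝ) : Measurable (gain T α c) :=
  (measurable_const.mul ((measurable_chi hT).comp measurable_snd)).mul
    ((measurable_pathLoss α).comp measurable_fst.norm)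

theorem mul_avgInterference_eq_tsum {Ω : Type*} {T : ℝ} (hT : 0 < T) (α : ℝ) {P s : ℝ}
    (hP : 0 ≤ P) (hs : 0 ≤ s) (Z : ℕ → Ω → TimeSpace) (g : ℕ → Ω → ℝ) (ω : Ω) :
    ENNReal.ofReal s * avgInterference T α P Z g ω
      = ∑' i, ENNReal.ofReal (gain T α (s * P) (Z i ω)) * ENNReal.ofReal (g i ω) := by
  rw [avgInterference_eq_tsum hT, ← ENNReal.tsum_mul_left]
  refine tsum_congr fun i => ?_
  rw [gain, ENNReal.ofReal_mul (mul_nonneg (mul_nonneg hs hP) (chi_nonneg hT _)),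
    ENNReal.ofReal_mul (mul_nonneg hs hP), ENNReal.ofReal_mul hs]
  ring

theorem lt_sinr_iff {Ω : Type*} {T α d σ ζ : ℝ} (hT : 0 < T) (hd : 0 ≤ d) (hζ : 0 < ζ)
    {P : Fin 2 → ℝ} (hP : ∀ n, 0 < P n) (Z : Fin 2 → ℕ → Ω → TimeSpace)
    (h : Fin 2 → Option ℕ → Ω → ℝ) (n : Fin 2) {s : ℝ} (hs : s = ζ * (1 + d ^ α) / P n) (ω : Ω) :
    ENNReal.ofReal ζ < sinr T α d σ P Z h n ω ↔
      ENNReal.ofReal (s * σ ^ 2) + ∑' k : Fin 2 × ℕ,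
        ENNReal.ofReal (gain T α (s * P k.1) (Z k.1 k.2 ω)) * ENNReal.ofReal (h k.1 (some k.2) ω)
        < ENNReal.ofReal (h n none ω) := by
  have hd1 : 0 < 1 + d ^ α := by have := Real.rpow_nonneg hd α; linarith
  have hs0 : 0 < s := by rw [hs]; have := hP n; positivity
  have hκ : 0 < P n * pathLoss α d := mul_pos (hP n) (pathLoss_pos α hd)
  have hζs : ζ = P n * pathLoss α d * s := by
    rw [hs, pathLoss]
    have := (hP n).ne'
    field_simp
  -- As `ζ` is finite and nonzero, the division can be cleared even if the denominator is `0` or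
  -- `∞`. The factor `P n * pathLoss α d` then cancels, leaving `s`.
  rw [sinr, ENNReal.lt_div_iff_mul_lt (Or.inr ENNReal.ofReal_ne_top)
    (Or.inr (by simpa using hζ)), mul_right_comm, ENNReal.ofReal_mul hκ.le]
  conv_lhs => rw [hζs, ENNReal.ofReal_mul hκ.le, mul_assoc]
  rw [ENNReal.mul_lt_mul_iff_right (by simpa using hκ) ENNReal.ofReal_ne_top, mul_add, mul_add,
    mul_avgInterference_eq_tsum hT α (hP 0).le hs0.le,
    mul_avgInterference_eq_tsum hT α (hP 1).le hs0.le, ← ENNReal.ofReal_mul hs0.le,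
    add_comm (_ + _) (ENNReal.ofReal _), ENNReal.tsum_prod', tsum_fintype (β := Fin 2), Fin.sum_univ_two]

/-! ### Counting measures and the conditional coverage probability. -/

theorem lintegral_countingMeasure {Ω E : Type*} [MeasurableSpace E] (Z : ℕ → Ω → E) (ω : Ω)
    {f : E → ℝ≥0∞} (hf : Measurable f) :
    ∫⁻ x, f x ∂countingMeasure Z ω = ∑' i, f (Z i ω) := by
  rw [countingMeasure, lintegral_sum_measure]
  exact tsum_congr fun i => lintegral_dirac' _ hf

theorem measurable_sum_dirac {ι E : Type*} [Countable ι] [MeasurableSpace E] :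
    Measurable fun z : ι → E => Measure.sum fun i => Measure.dirac (z i) := by
  refine Measure.measurable_of_measurable_coe _ fun s hs => ?_
  simp only [Measure.sum_apply _ hs]
  exact Measurable.tsum fun i => (Measure.measurable_coe hs).comp
    (Measure.measurable_dirac.comp (measurable_pi_apply i))

/-- Forgetting the labels of the points is measurable. Freezing is done on the labelled points, so
`pointSigma` must be coarser than the σ-algebra they generate. -/
theorem comap_countingMeasure_le {Ω : Type*} (Z : Fin 2 → ℕ → Ω → TimeSpace) (m : Fin 2) :
    MeasurableSpace.comap (countingMeasure (Z m)) inferInstance ≤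
      MeasurableSpace.comap (fun ω (k : Fin 2 × ℕ) => Z k.1 k.2 ω) inferInstance := by
  have h1 : Measurable fun z : Fin 2 × ℕ → TimeSpace =>
      Measure.sum fun i => Measure.dirac (z (m, i)) :=
    measurable_sum_dirac.comp (measurable_pi_lambda _ fun i => measurable_pi_apply (m, i))
  have h2 : countingMeasure (Z m) = (fun z : Fin 2 × ℕ → TimeSpace =>
      Measure.sum fun i => Measure.dirac (z (m, i))) ∘ fun ω (k : Fin 2 × ℕ) => Z k.1 k.2 ω := rfl
  rw [h2, ← MeasurableSpace.comap_comp]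
  exact MeasurableSpace.comap_mono h1.comap_le

theorem measurable_lintegral_countingMeasure_pointSigma {Ω : Type*} (Z : Fin 2 → ℕ → Ω → TimeSpace)
    (m : Fin 2) {f : TimeSpace → ℝ≥0∞} (hf : Measurable f) :
    Measurable[pointSigma Z] fun ω => ∫⁻ x, f x ∂countingMeasure (Z m) ω := by
  refine (Measure.measurable_lintegral hf).comp (Measurable.of_comap_le ?_)
  fin_cases m
  · exact le_sup_left
  · exact le_sup_right

/-- The exponent of the conditional coverage probability contributed by the point `x`. -/
noncomputable def logGain (T α c : ℝ) (x : TimeSpace) : ℝ≥0∞ :=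
  ENNReal.ofReal (Real.log (1 + gain T α c x))

theorem measurable_logGain {T : ℝ} (hT : 0 < T) (α c : ℝ) : Measurable (logGain T α c) :=
  (Real.measurable_log.comp ((measurable_gain hT α c).const_add 1)).ennreal_ofReal

theorem condCoverage_ae_eq {Ω : Type*} [MeasurableSpace Ω] {μ : Measure Ω} [IsProbabilityMeasure μ]
    {T α d σ ζ : ℝ} (hT : 0 < T) (hd : 0 ≤ d) (hζ : 0 < ζ)
    {P lam : Fin 2 → ℝ} (hP : ∀ n, 0 < P n)
    {Z : Fin 2 → ℕ → Ω → TimeSpace} {h : Fin 2 → Option ℕ → Ω → ℝ}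
    (hmodel : IsModel μ lam Z h) (n : Fin 2) {s : ℝ} (hs : s = ζ * (1 + d ^ α) / P n) :
    condCoverage μ T α d σ P Z h n ζ =ᵐ[μ] fun ω =>
      (expNeg (ENNReal.ofReal (s * σ ^ 2) +
        ∑ m, ∫⁻ x, logGain T α (s * P m) x ∂countingMeasure (Z m) ω)).toReal := by
  have hd1 : 0 < 1 + d ^ α := by have := Real.rpow_nonneg hd α; linarith
  have hs0 : 0 < s := by rw [hs]; have := hP n; positivity
  set Y : Ω → Fin 2 × ℕ → TimeSpace := fun ω k => Z k.1 k.2 ω with hYdef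
  set H : Ω → Fin 2 × Option ℕ → ℝ := fun ω k => h k.1 k.2 ω with hHdef
  have hY : Measurable Y := measurable_pi_lambda _ fun k => hmodel.measurable_point _ _
  have hH : Measurable H := measurable_pi_lambda _ fun k => hmodel.measurable_fading _ _
  set A : Set ((Fin 2 × ℕ → TimeSpace) × (Fin 2 × Option ℕ → ℝ)) :=
    {p | ENNReal.ofReal (s * σ ^ 2) + ∑' k : Fin 2 × ℕ,
        ENNReal.ofReal (gain T α (s * P k.1) (p.1 k)) * ENNReal.ofReal (p.2 (k.1, some k.2))
        < ENNReal.ofReal (p.2 (n, none))} with hAdef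
  have hA : MeasurableSet A := by
    refine measurableSet_lt (Measurable.const_add (Measurable.tsum fun k => ?_) _) ?_
    · exact ((measurable_gain hT α _).comp
        ((measurable_pi_apply k).comp measurable_fst)).ennreal_ofReal.mul
        ((measurable_pi_apply _).comp measurable_snd).ennreal_ofReal
    · exact ((measurable_pi_apply _).comp measurable_snd).ennreal_ofReal
  have hset : {ω | ENNReal.ofReal ζ < sinr T α d σ P Z h n ω} = {ω | (Y ω, H ω) ∈ A} := by
    ext ω
    exact lt_sinr_iff hT hd hζ hP Z h n hs ω
  have hG (y : Fin 2 × ℕ → TimeSpace) : μ {ω | (y, H ω) ∈ A} =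
      expNeg (ENNReal.ofReal (s * σ ^ 2) + ∑' k : Fin 2 × ℕ, logGain T α (s * P k.1) (y k)) := by
    have hinj : Function.Injective fun k : Fin 2 × ℕ => (k.1, some k.2) := by
      rintro ⟨a, i⟩ ⟨b, j⟩ hab
      simpa using hab
    have hrange : (n, none) ∉ Set.range fun k : Fin 2 × ℕ => (k.1, some k.2) := by
      rintro ⟨k, hk⟩
      simp at hk
    have := measure_const_add_tsum_lt (X := fun (k : Fin 2 × Option ℕ) => h k.1 k.2)
      (a := fun k => gain T α (s * P k.1) (y k))
      (fun k => hmodel.measurable_fading _ _) (fun k => hmodel.map_fading _ _)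
      hmodel.iIndep_fading hinj hrange
      (fun k => gain_nonneg hT α (mul_pos hs0 (hP _)).le _) (ENNReal.ofReal (s * σ ^ 2))
    exact this
  -- The exponent does not depend on the labelling, which makes the frozen probability measurable
  -- for `pointSigma`.
  have hsum (ω : Ω) : ∑' k : Fin 2 × ℕ, logGain T α (s * P k.1) (Y ω k) =
      ∑ m, ∫⁻ x, logGain T α (s * P m) x ∂countingMeasure (Z m) ω := by
    rw [ENNReal.tsum_prod', tsum_fintype (β := Fin 2)]
    exact Finset.sum_congr rfl fun m _ =>
      (lintegral_countingMeasure (Z m) ω (measurable_logGain hT α (s * P m))).symm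
  have hmeas : Measurable[pointSigma Z] fun ω => expNeg (ENNReal.ofReal (s * σ ^ 2) +
      ∑' k : Fin 2 × ℕ, logGain T α (s * P k.1) (Y ω k)) := by
    simp_rw [hsum]
    exact measurable_expNeg.comp (measurable_const.add (Finset.measurable_fun_sum _ fun m _ =>
      measurable_lintegral_countingMeasure_pointSigma Z m (measurable_logGain hT α _)))
  have key := condExp_indicator_of_indepFun hY hH hmodel.indep_points_fading hA
    (m := pointSigma Z) (sup_le (comap_countingMeasure_le Z 0) (comap_countingMeasure_le Z 1))
    hG hmeas
  simp_rw [hsum] at key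
  rw [condCoverage, hset]
  exact key

/-! ### The intensity integral. -/

theorem one_sub_sq_nonneg {a : ℝ} (ha : 0 ≤ a) : 0 ≤ 1 - (1 / (1 + a)) ^ 2 := by
  have h0 : 0 ≤ 1 / (1 + a) := by positivity
  have h1 : 1 / (1 + a) ≤ 1 := (div_le_one (by linarith)).2 (by linarith)
  nlinarith

/-- With `y = 1 / (1 + a)`, `1 - y² = 2 (1 - y) - (1 - y)²` and `1 - y ≤ a`. The bound dominates the
integrand by a product of a function of space and one of time. -/
theorem one_sub_sq_le {a : ℝ} (ha : 0 ≤ a) : 1 - (1 / (1 + a)) ^ 2 ≤ 2 * a := by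
  have h0 : 1 - a ≤ 1 / (1 + a) := by
    rw [le_div_iff₀ (by linarith)]
    nlinarith [sq_nonneg a]
  nlinarith [sq_nonneg (1 - 1 / (1 + a))]

/-- Comparison with `(1 + ‖x‖) ^ (-α)`, integrable because `α` exceeds the dimension `2`. -/
theorem integrable_pathLoss_norm {α : ℝ} (hα : 2 < α) :
    Integrable fun x : Plane => pathLoss α ‖x‖ := by
  have hr : (Module.finrank ℝ Plane : ℝ) < α := by simpa using hα
  refine ((integrable_one_add_norm (μ := volume) hr).const_mul (2 ^ α)).mono'
    ((measurable_pathLoss α).comp measurable_norm).aestronglyMeasurable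
    (ae_of_all _ fun x => ?_)
  have hx := norm_nonneg x
  have hα0 : 0 ≤ α := by linarith
  have hxp : 0 ≤ ‖x‖ ^ α := Real.rpow_nonneg hx α
  rw [Real.norm_of_nonneg (pathLoss_pos α hx).le, pathLoss, Real.rpow_neg (by positivity)]
  rw [← div_eq_mul_inv, inv_eq_one_div, div_le_div_iff₀ (by positivity) (by positivity), one_mul]
  have h2 : 1 + ‖x‖ ≤ 2 * max 1 ‖x‖ := by
    linarith [le_max_left 1 ‖x‖, le_max_right 1 ‖x‖]
  calc (1 + ‖x‖) ^ α ≤ (2 * max 1 ‖x‖) ^ α := Real.rpow_le_rpow (by positivity) h2 hα0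
    _ = 2 ^ α * (max 1 ‖x‖) ^ α := Real.mul_rpow (by norm_num) (by positivity)
    _ ≤ 2 ^ α * (1 + ‖x‖ ^ α) := by
      refine mul_le_mul_of_nonneg_left ?_ (by positivity)
      rcases le_total 1 ‖x‖ with h | h
      · rw [max_eq_right h]
        linarith
      · rw [max_eq_left h, Real.one_rpow]
        linarith

theorem integrable_chi {T : ℝ} (hT : 0 < T) : Integrable (chi T) := by
  have h1 : Integrable ((Set.Icc (-T) T).indicator fun _ => (1 : ℝ)) :=
    (integrable_indicator_iff measurableSet_Icc).2 (integrableOn_const (by simp))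
  refine h1.mono' (measurable_chi hT).aestronglyMeasurable (ae_of_all _ fun τ => ?_)
  rw [Real.norm_of_nonneg (chi_nonneg hT τ)]
  by_cases hτ : τ ∈ Set.Icc (-T) T
  · rw [Set.indicator_of_mem hτ]
    exact chi_le_one hT τ
  · rw [Set.indicator_of_notMem hτ, ← chi_abs hT]
    refine (chi_eq_zero hT ?_).le
    by_contra hle
    exact hτ (abs_le.1 (not_lt.1 hle))

theorem measurable_one_sub_sq_gain {T : ℝ} (hT : 0 < T) (α c : ℝ) :
    Measurable fun x => 1 - (1 / (1 + gain T α c x)) ^ 2 :=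
  measurable_const.sub ((measurable_const.div ((measurable_gain hT α c).const_add 1)).pow_const 2)

theorem integrable_one_sub_sq_gain {T α : ℝ} (hT : 0 < T) (hα : 2 < α) {c : ℝ} (hc : 0 ≤ c) :
    Integrable fun x : TimeSpace => 1 - (1 / (1 + gain T α c x)) ^ 2 := by
  have h1 : Integrable (fun x : TimeSpace => pathLoss α ‖x.1‖ * chi T x.2)
      ((volume : Measure Plane).prod (volume : Measure ℝ)) :=
    (integrable_pathLoss_norm hα).mul_prod (integrable_chi hT)
  refine (h1.const_mul (2 * c)).mono' (measurable_one_sub_sq_gain hT α c).aestronglyMeasurable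
    (ae_of_all _ fun x => ?_)
  have h0 := gain_nonneg hT α hc x
  rw [Real.norm_of_nonneg (one_sub_sq_nonneg h0)]
  refine (one_sub_sq_le h0).trans (le_of_eq ?_)
  rw [gain]
  ring

theorem integral_fun_norm_plane (f : ℝ → ℝ) :
    ∫ x : Plane, f ‖x‖ = 2 * Real.pi * ∫ u in Set.Ioi (0 : ℝ), f u * u := by
  have hball : (volume : Measure Plane).real (Metric.ball 0 1) = Real.pi := by
    simp [measureReal_def, Real.pi_pos.le]
  rw [integral_fun_norm_addHaar volume f, hball, finrank_euclideanSpace_fin, nsmul_eq_mul,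
    smul_eq_mul, mul_assoc]
  simp only [smul_eq_mul, Nat.add_one_sub_one, pow_one, mul_comm, Nat.cast_ofNat]

theorem integral_one_sub_sq_gain {T α : ℝ} (hT : 0 < T) (hα : 2 < α) {c : ℝ} (hc : 0 ≤ c) :
    ∫ x : TimeSpace, (1 - (1 / (1 + gain T α c x)) ^ 2) = 4 * Real.pi *
      ∫ t in (0 : ℝ)..T, ∫ u in Set.Ioi (0 : ℝ),
        (1 - (1 / (1 + c * chi T t * (1 + u ^ α)⁻¹)) ^ 2) * u := by
  set K : ℝ → ℝ := fun t => ∫ u in Set.Ioi (0 : ℝ),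
        (1 - (1 / (1 + c * chi T t * (1 + u ^ α)⁻¹)) ^ 2) * u with hK
  have hinner (t : ℝ) :
      ∫ x : Plane, (1 - (1 / (1 + gain T α c (x, t))) ^ 2) = 2 * Real.pi * K t :=
    integral_fun_norm_plane fun u => 1 - (1 / (1 + c * chi T t * (1 + u ^ α)⁻¹)) ^ 2
  have hKabs (t : ℝ) : K t = K |t| := by simp only [hK, chi_abs hT]
  have hKint : ∫ t, K t = 2 * ∫ t in (0 : ℝ)..T, K t := by
    rw [integral_congr_ae (ae_of_all _ hKabs), integral_comp_abs (f := K),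
      intervalIntegral.integral_of_le hT.le]
    congr 1
    -- Beyond `T` the activity `chi` vanishes, so the integrand is `(1 - 1) * u = 0`.
    refine setIntegral_eq_of_subset_of_forall_sdiff_eq_zero measurableSet_Ioi
      Set.Ioc_subset_Ioi_self fun t ht => ?_
    have hTt : T < t := by
      by_contra hle
      exact ht.2 ⟨ht.1, not_lt.1 hle⟩
    simp [hK, chi_eq_zero hT hTt]
  rw [Measure.volume_eq_prod, integral_prod_symm _ (integrable_one_sub_sq_gain hT hα hc)]
  simp_rw [hinner]
  rw [integral_const_mul, hKint]
  ring

/-! ### The second moment. -/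

theorem expNeg_lintegral_eq_laplaceSq {T α : ℝ} (hT : 0 < T) (hα : 2 < α) {lam P s : ℝ}
    (hlam : 0 ≤ lam) (hc : 0 ≤ s * P) :
    expNeg (∫⁻ x, (1 - expNeg (2 * logGain T α (s * P) x)) ∂(ENNReal.ofReal lam • volume))
      = ENNReal.ofReal (laplaceSq T α lam P s) := by
  have hpt (x : TimeSpace) : 1 - expNeg (2 * logGain T α (s * P) x)
      = ENNReal.ofReal (1 - (1 / (1 + gain T α (s * P) x)) ^ 2) := by
    have h0 := gain_nonneg hT α hc x
    rw [two_mul, expNeg_add, logGain, expNeg_ofReal_log_one_add h0, ← sq,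
      ← ENNReal.ofReal_pow (by positivity), ENNReal.ofReal_sub _ (by positivity),
      ENNReal.ofReal_one]
  have hnn : 0 ≤ ∫ x : TimeSpace, (1 - (1 / (1 + gain T α (s * P) x)) ^ 2) :=
    integral_nonneg fun x => one_sub_sq_nonneg (gain_nonneg hT α hc x)
  simp_rw [hpt]
  rw [lintegral_smul_measure, ← ofReal_integral_eq_lintegral_ofReal
    (integrable_one_sub_sq_gain hT hα hc)
    (ae_of_all _ fun x => one_sub_sq_nonneg (gain_nonneg hT α hc x)), smul_eq_mul,
    ← ENNReal.ofReal_mul hlam, expNeg_ofReal (mul_nonneg hlam hnn),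
    integral_one_sub_sq_gain hT hα hc, laplaceSq]
  congr 2
  ring

theorem laplaceSq_nonneg (T α lam P s : ℝ) : 0 ≤ laplaceSq T α lam P s := (Real.exp_pos _).le

theorem lintegral_expNeg_sum_countingMeasure {Ω : Type*} [MeasurableSpace Ω] {μ : Measure Ω}
    [IsProbabilityMeasure μ] {lam : Fin 2 → ℝ} {Z : Fin 2 → ℕ → Ω → TimeSpace}
    {h : Fin 2 → Option ℕ → Ω → ℝ} (hmodel : IsModel μ lam Z h)
    {f : Fin 2 → TimeSpace → ℝ≥0∞} (hf : ∀ m, Measurable (f m)) :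
    ∫⁻ ω, expNeg (∑ m, ∫⁻ x, f m x ∂countingMeasure (Z m) ω) ∂μ =
      ∏ m, expNeg (∫⁻ x, (1 - expNeg (f m x)) ∂(ENNReal.ofReal (lam m) • volume)) := by
  have hF (m : Fin 2) : Measurable fun z : ℕ → TimeSpace => expNeg (∑' i, f m (z i)) :=
    measurable_expNeg.comp (Measurable.tsum fun i => (hf m).comp (measurable_pi_apply i))
  have hZ (m : Fin 2) : Measurable fun ω i => Z m i ω :=
    measurable_pi_lambda _ fun i => hmodel.measurable_point m i
  have hcount (m : Fin 2) (ω : Ω) : expNeg (∫⁻ x, f m x ∂countingMeasure (Z m) ω)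
      = expNeg (∑' i, f m (Z m i ω)) := by
    rw [lintegral_countingMeasure _ _ (hf m)]
  have hsf (m : Fin 2) : SigmaFinite (ENNReal.ofReal (lam m) • (volume : Measure TimeSpace)) :=
    inferInstanceAs (SigmaFinite ((lam m).toNNReal • (volume : Measure TimeSpace)))
  simp_rw [expNeg_sum, Fin.prod_univ_two]
  rw [← (hmodel.isPoisson 0).lintegral_expNeg (hf 0), ← (hmodel.isPoisson 1).lintegral_expNeg (hf 1)]
  simp_rw [hcount]
  exact lintegral_mul_eq_lintegral_mul_lintegral_of_indepFun'' ((hF 0).comp (hZ 0)).aemeasurable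
    ((hF 1).comp (hZ 1)).aemeasurable (hmodel.indep_points.comp (hF 0) (hF 1))

end AsyncNetwork

open AsyncNetwork in
theorem mainTheorem7 {Ω : Type*} [MeasurableSpace Ω] (μ : Measure Ω) [IsProbabilityMeasure μ]
    (T α d σ ζ : ℝ) (hT : 0 < T) (hα : 2 < α) (hd : 0 ≤ d) (hζ : 0 < ζ)
    (P lam : Fin 2 → ℝ) (hP : ∀ n, 0 < P n) (hlam : ∀ n, 0 < lam n)
    (Z : Fin 2 → ℕ → Ω → TimeSpace) (h : Fin 2 → Option ℕ → Ω → ℝ)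
    (hmodel : IsModel μ lam Z h) (n : Fin 2) (s : ℝ) (hs : s = ζ * (1 + d ^ α) / P n) :
    Integrable (fun ω => condCoverage μ T α d σ P Z h n ζ ω ^ 2) μ ∧
      ∫ ω, condCoverage μ T α d σ P Z h n ζ ω ^ 2 ∂μ =
        laplaceSq T α (lam 0) (P 0) s * laplaceSq T α (lam 1) (P 1) s *
          Real.exp (-2 * σ ^ 2 * s) := by
  have hd1 : 0 < 1 + d ^ α := by have := Real.rpow_nonneg hd α; linarith
  have hs0 : 0 < s := by rw [hs]; have := hP n; positivity
  have hsσ : 0 ≤ s * σ ^ 2 := by positivity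
  -- The squared conditional coverage in `[0, ∞]`: doubling the exponent and moving the `2` inside
  -- the integrals leaves a Laplace functional.
  set q : Ω → ENNReal := fun ω => expNeg (2 * ENNReal.ofReal (s * σ ^ 2)) *
    expNeg (∑ m, ∫⁻ x, 2 * logGain T α (s * P m) x ∂countingMeasure (Z m) ω) with hq
  have hmL (m : Fin 2) : Measurable fun x => 2 * logGain T α (s * P m) x :=
    (measurable_logGain hT α _).const_mul 2
  have hmS : Measurable fun ω => expNeg
      (∑ m, ∫⁻ x, 2 * logGain T α (s * P m) x ∂countingMeasure (Z m) ω) :=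
    measurable_expNeg.comp (Finset.measurable_fun_sum _ fun m _ =>
      (Measure.measurable_lintegral (hmL m)).comp (hmodel.isPoisson m).measurable)
  have hqm : Measurable q := hmS.const_mul _
  have hq1 (ω : Ω) : q ω ≤ 1 := mul_le_one' (expNeg_le_one _) (expNeg_le_one _)
  have hae : (fun ω => condCoverage μ T α d σ P Z h n ζ ω ^ 2) =ᵐ[μ] fun ω => (q ω).toReal := by
    filter_upwards [condCoverage_ae_eq hT hd hζ hP hmodel n hs (σ := σ)] with ω hω
    rw [hω, ← ENNReal.toReal_pow, ← expNeg_nat_mul, Nat.cast_ofNat, mul_add, expNeg_add,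
      Finset.mul_sum, hq]
    simp_rw [lintegral_const_mul _ (measurable_logGain hT α _)]
  have hint : Integrable (fun ω => (q ω).toReal) μ := by
    refine Integrable.of_bound hqm.ennreal_toReal.aestronglyMeasurable 1 (ae_of_all _ fun ω => ?_)
    rw [Real.norm_of_nonneg ENNReal.toReal_nonneg]
    simpa using ENNReal.toReal_mono ENNReal.one_ne_top (hq1 ω)
  refine ⟨hint.congr hae.symm, ?_⟩
  rw [integral_congr_ae hae, integral_toReal hqm.aemeasurable
    (ae_of_all _ fun ω => (hq1 ω).trans_lt ENNReal.one_lt_top), hq,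
    lintegral_const_mul _ hmS, lintegral_expNeg_sum_countingMeasure hmodel hmL, Fin.prod_univ_two,
    expNeg_lintegral_eq_laplaceSq hT hα (hlam 0).le (mul_pos hs0 (hP 0)).le,
    expNeg_lintegral_eq_laplaceSq hT hα (hlam 1).le (mul_pos hs0 (hP 1)).le,
    two_mul, ← ENNReal.ofReal_add hsσ hsσ, expNeg_ofReal (add_nonneg hsσ hsσ), mul_comm,
    ENNReal.toReal_mul, ENNReal.toReal_mul, ENNReal.toReal_ofReal (laplaceSq_nonneg _ _ _ _ _),
    ENNReal.toReal_ofReal (laplaceSq_nonneg _ _ _ _ _), ENNReal.toReal_ofReal (Real.exp_pos _).le]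
  congr 2
  ring
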